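/- All graphs are finite and simple, and $G[S]$ denotes the subgraph of $G$ induced by $S\subseteq V(G)$. Let $H$ be a graph and $U\subseteq V(H)$. A graph $H'$ is a *$U$-prescribed blow-up* of $H$ if $V(H')$ can be partitioned into nonempty sets $(V_i)_{i\in V(H)}$ such that $V_i$ is complete to $V_j$ whenever $ij\in E(H)$, and $V_i$ is a clique for every $i\in U$. For disjoint $U_+,U_-\subseteq V(H)$, a graph $H'$ is a *$(U_+,U_-)$-prescribed induced blow-up* of $H$ if $V(H')$ can be partitioned into nonempty sets $(V_i)_{i\in V(H)}$ such that, for all $i\neq j$, $V_i$ is complete to $V_j$ if $ij\in E(H)$ and there are no edges between $V_i$ and $V_j$ if $ij\notin E(H)$; $V_i$ is a clique for every $i\in U_+$; and $V_i$ is an independent set for every $i\in U_-$. A set $S\subseteq V(G)$ *corresponds to a maximal* blow-up of one of these kinds if $G[S]$ is a blow-up of that kind and there is no $S'$ with $S\subsetneq S'\subseteq V(G)$ such that $G[S']$ is a blow-up of that kind. **Theorem.** Let $d\ge 2$ be an integer, and let $H$ be a connected graph with maximum degree $d$ and $N$ vertices, where $N>d^{d^{d^d}}$. Then there is a graph $G$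 with $$N\le |V(G)|\le 2^{d^{21d+20}}N$$ and maximum degree at most $d\,2^{d^{21d+20}}$ such that the following hold. 1. For every $U\subseteq V(H)$, at least $2^{|V(G)|/2^{d^{21d+20}}}$ vertex sets in $G$ correspond to maximal $U$-prescribed blow-ups of $H$. 2. For all disjoint $U_+,U_-\subseteq V(H)$, at least $2^{|V(G)|/2^{d^{21d+20}}}$ vertex sets in $G$ correspond to maximal $(U_+,U_-)$-prescribed induced blow-ups of $H$. -/

import Mathlib

/-- `K` is a `U`-clique prescribed blow-up of `H`. The map `φ` is the vertex partition: the group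
of the vertex `i` of `H` is the fibre `φ ⁻¹' {i}`, and surjectivity says that every group is
nonempty. Groups of adjacent vertices of `H` are complete to each other, and the groups of the
vertices in `U` are cliques. -/
def IsPrescribedBlowUp {V W : Type*} (H : SimpleGraph V) (U : Set V) (K : SimpleGraph W) : Prop :=
  ∃ φ : W → V, Function.Surjective φ ∧
    (∀ x y : W, H.Adj (φ x) (φ y) → K.Adj x y) ∧
    ∀ i ∈ U, K.IsClique (φ ⁻¹' {i})

/-- `K` is a `(Up, Um)`-prescribed induced blow-up of `H`: the groups are the (nonempty) fibres of
`φ`, two distinct groups are complete or empty to each other according to whether the corresponding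
vertices of `H` are adjacent or not, the groups of the vertices in `Up` are cliques and those of
the vertices in `Um` are independent sets. -/
def IsPrescribedInducedBlowUp {V W : Type*} (H : SimpleGraph V) (Up Um : Set V)
    (K : SimpleGraph W) : Prop :=
  ∃ φ : W → V, Function.Surjective φ ∧
    (∀ x y : W, H.Adj (φ x) (φ y) → K.Adj x y) ∧
    (∀ x y : W, φ x ≠ φ y → ¬ H.Adj (φ x) (φ y) → ¬ K.Adj x y) ∧
    (∀ i ∈ Up, K.IsClique (φ ⁻¹' {i})) ∧
    ∀ i ∈ Um, K.IsIndepSet (φ ⁻¹' {i})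

/-- The vertex sets `S` of `G` such that `G[S]` is a maximal `U`-prescribed blow-up of `H`:
maximality is with respect to inclusion of vertex sets, with no vertex partition fixed. -/
def maximalPrescribedBlowUps {V W : Type*} (H : SimpleGraph V) (U : Set V)
    (G : SimpleGraph W) : Set (Set W) :=
  {S | Maximal (fun S' : Set W => IsPrescribedBlowUp H U (G.induce S')) S}

/-- The vertex sets `S` of `G` such that `G[S]` is a maximal `(Up, Um)`-prescribed induced blow-up
of `H`. -/
def maximalPrescribedInducedBlowUps {V W : Type*} (H : SimpleGraph V) (Up Um : Set V)
    (G : SimpleGraph W) : Set (Set W) :=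
  {S | Maximal (fun S' : Set W => IsPrescribedInducedBlowUp H Up Um (G.induce S')) S}

/-! Let `C` be a set of vertices of `H` at pairwise distance at least 3, with `N ≤ q * |C|` for `q =
1 + d + d²`. Give each centre in `C` a label from `A × A`, where `|A| = k`, and let `G` be the union
of the resulting copies of `H`. A centre shows its whole label, its neighbours only the first half.
So there are `k²` labels per centre, but degrees in `G` are at most `d * k` (`copyGraph_degree_le`).
A blow-up of `H` in `G` has at most `d * k * N ≤ K * |C|` vertices, where `K = d * q * k = k² / 2`.
By AM-GM it contains at most `K ^ |C|` of the `(2K) ^ |C|` labelled copies. Each copy is induced,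
hence a blow-up of either kind, and extends to a maximal one, so there are at least `2 ^ |C|`
maximal ones. -/

/-- Integer form of the AM-GM inequality. -/
theorem prod_le_pow_card_of_sum_le {ι : Type*} [Fintype ι] (x : ι → ℕ) (K : ℕ)
    (h : ∑ i, x i ≤ K * Fintype.card ι) : ∏ i, x i ≤ K ^ Fintype.card ι := by
  rcases Nat.eq_zero_or_pos K with rfl | hK
  · have h0 : ∀ i, x i = 0 := by simpa using h
    simp [h0]
  have hK' : (0 : ℝ) < K := by exact_mod_cast hK
  have h' : (∑ i, (x i : ℝ)) ≤ K * Fintype.card ι := by exact_mod_cast h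
  have key : ∏ i, ((x i : ℝ) / K) ≤ 1 := by
    calc ∏ i, ((x i : ℝ) / K) ≤ ∏ i, Real.exp ((x i : ℝ) / K - 1) := by
          refine Finset.prod_le_prod (fun i _ => by positivity) fun i _ => ?_
          simpa using Real.add_one_le_exp ((x i : ℝ) / K - 1)
      _ = Real.exp (∑ i, ((x i : ℝ) / K - 1)) := (Real.exp_sum _ _).symm
      _ ≤ 1 := by
          rw [Real.exp_le_one_iff, Finset.sum_sub_distrib, ← Finset.sum_div, sub_nonpos,
            div_le_iff₀ hK']
          simpa [mul_comm] using h'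
  rw [Finset.prod_div_distrib, Finset.prod_const, Finset.card_univ,
    div_le_one (by positivity)] at key
  exact_mod_cast key

/-- A family of sets `S ε`, indexed by choice functions `ε`, in which `S ε` remembers `ε` through
the points `p i (ε i)`, has many maximal members of `P` above it if members of `P` are small. -/
theorem two_pow_card_le_ncard_maximal {ι L W : Type*} [Fintype ι] [Fintype L] [Finite W]
    (P : Set W → Prop) (S : (ι → L) → Set W) (p : ι → L → W)
    (hp : Function.Injective (Function.uncurry p)) (hS : ∀ ε, P (S ε))
    (hpS : ∀ ε i, p i (ε i) ∈ S ε) (K : ℕ) (hK : 0 < K) (hL : Fintype.card L = 2 * K)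
    (hP : ∀ B, P B → B.ncard ≤ K * Fintype.card ι) :
    2 ^ Fintype.card ι ≤ {B | Maximal P B}.ncard := by
  classical
  have hex : ∀ ε, ∃ B, S ε ⊆ B ∧ Maximal P B := fun ε => Finite.exists_le_maximal (hS ε)
  choose B hSB hB using hex
  have hfin : {B | Maximal P B}.Finite := Set.toFinite _
  have hfib : ∀ M ∈ hfin.toFinset,
      ({ε ∈ (Finset.univ : Finset (ι → L)) | B ε = M}).card ≤ K ^ Fintype.card ι := by
    intro M hM
    have hM' : Maximal P M := by simpa using hM
    -- A choice `ε` with `S ε ⊆ M` takes its values in the sets `t i`. As `p` is injective, their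
    -- sizes sum to at most `|M|`, so AM-GM bounds the number of such choices.
    let t : ι → Finset L := fun i => {l | p i l ∈ M}
    have hsub : ({ε ∈ (Finset.univ : Finset (ι → L)) | B ε = M}) ⊆ Fintype.piFinset t := by
      intro ε hε
      simp only [Finset.mem_filter, Finset.mem_univ, true_and] at hε
      simp only [Fintype.mem_piFinset, t, Finset.mem_filter, Finset.mem_univ, true_and]
      exact fun i => hε ▸ hSB ε (hpS ε i)
    refine (Finset.card_le_card hsub).trans ?_
    rw [Fintype.card_piFinset]
    refine prod_le_pow_card_of_sum_le _ _ (le_trans ?_ (hP M hM'.prop))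
    rw [← Finset.card_sigma, ← Set.ncard_coe_finset]
    refine Set.ncard_le_ncard_of_injOn (fun q : (_ : ι) × L => p q.1 q.2) ?_ ?_ (Set.toFinite _)
    · rintro ⟨i, l⟩ h
      simpa [t] using h
    · rintro ⟨i, l⟩ - ⟨j, l'⟩ - h
      have := @hp (i, l) (j, l') h
      simp only [Prod.mk.injEq] at this
      obtain ⟨rfl, rfl⟩ := this
      rfl
  have hcard := Finset.card_le_mul_card_image_of_maps_to (f := B) (s := Finset.univ)
    (t := hfin.toFinset) (fun ε _ => by simpa using hB ε) _ hfib
  rw [Finset.card_univ, Fintype.card_fun, hL, mul_pow, mul_comm,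
    ← Set.ncard_eq_toFinset_card _ hfin] at hcard
  exact Nat.le_of_mul_le_mul_left hcard (by positivity)

theorem IsPrescribedInducedBlowUp.isPrescribedBlowUp {V W : Type*} {H : SimpleGraph V}
    {Up Um : Set V} {K : SimpleGraph W} (h : IsPrescribedInducedBlowUp H Up Um K) :
    IsPrescribedBlowUp H Up K := by
  obtain ⟨φ, h1, h2, -, h4, -⟩ := h
  exact ⟨φ, h1, h2, h4⟩

/-- Each group of a blow-up lies in the neighbourhood of a single vertex. -/
theorem IsPrescribedBlowUp.ncard_le {V W : Type*} [Fintype V] [Fintype W] {H : SimpleGraph V}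
    {U : Set V} {G : SimpleGraph W} [DecidableRel G.Adj] {B : Set W}
    (hB : IsPrescribedBlowUp H U (G.induce B)) (hadj : ∀ u, ∃ v, H.Adj u v) (D : ℕ)
    (hD : ∀ x, G.degree x ≤ D) : B.ncard ≤ D * Fintype.card V := by
  classical
  obtain ⟨φ, hφ, hc, -⟩ := hB
  rw [← Nat.card_coe_set_eq, Nat.card_eq_fintype_card, ← Finset.card_univ, ← Finset.card_univ]
  refine Finset.card_le_mul_card_image_of_maps_to (f := φ) (fun _ _ => Finset.mem_univ _) D ?_
  intro i _
  obtain ⟨j, hij⟩ := hadj i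
  obtain ⟨y, rfl⟩ := hφ j
  refine le_trans ?_ (hD y)
  rw [← G.card_neighborFinset_eq_degree]
  refine Finset.card_le_card_of_injOn (fun x => (x : W)) ?_ (Subtype.val_injective.injOn)
  intro x hx
  simp only [Finset.coe_filter, Finset.mem_univ, true_and, Set.mem_ofPred_eq] at hx
  have := hc y x (by rw [hx]; exact hij.symm)
  simpa using this

/-- An induced copy of `H` is a blow-up of `H` for every prescription. -/
theorem isPrescribedInducedBlowUp_range {V W : Type*} {H : SimpleGraph V} (Up Um : Set V)
    {G : SimpleGraph W} (f : H ↪g G) :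
    IsPrescribedInducedBlowUp H Up Um (G.induce (Set.range f)) := by
  let φ : Set.range f → V := fun x => x.2.choose
  have hφ : ∀ x, f (φ x) = x := fun x => x.2.choose_spec
  have hinj : Function.Injective φ := fun x y h => by
    apply Subtype.ext
    rw [← hφ x, ← hφ y, h]
  have hadj : ∀ x y, (G.induce (Set.range f)).Adj x y ↔ H.Adj (φ x) (φ y) := fun x y => by
    rw [← f.map_adj_iff, hφ, hφ]
    simp
  refine ⟨φ, fun u => ⟨⟨f u, u, rfl⟩, f.injective (hφ _)⟩, fun x y h => (hadj x y).2 h,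
    fun x y _ h h' => h ((hadj x y).1 h'), ?_, ?_⟩
  -- The groups are singletons, hence both cliques and independent sets.
  all_goals
    intro i _ x hx y hy hxy
    exact absurd (hinj (hx.trans hy.symm)) hxy

/-- A large set of vertices at pairwise distance at least three. -/
theorem exists_scattered {V : Type*} [Fintype V] (H : SimpleGraph V) [DecidableRel H.Adj]
    (d : ℕ) (hd : ∀ u, H.degree u ≤ d) :
    ∃ C : Finset V, (∀ u ∈ C, ∀ v ∈ C, ¬ H.Adj u v) ∧
      (∀ w, ∀ u ∈ C, ∀ v ∈ C, H.Adj w u → H.Adj w v → u = v) ∧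
      Fintype.card V ≤ C.card * (1 + d + d * d) := by
  classical
  let P : Finset V → Prop := fun C => (∀ u ∈ C, ∀ v ∈ C, ¬ H.Adj u v) ∧
      (∀ w, ∀ u ∈ C, ∀ v ∈ C, H.Adj w u → H.Adj w v → u = v)
  obtain ⟨C, -, hC⟩ := Finite.exists_le_maximal (p := P) (a := ∅) (by simp [P])
  refine ⟨C, hC.prop.1, hC.prop.2, ?_⟩
  -- The balls of radius 2 around a maximal `C` cover `V`, since an uncovered vertex could be added
  -- to `C`.
  let ball : V → Finset V := fun v =>
    insert v (H.neighborFinset v) ∪ (H.neighborFinset v).biUnion fun w => H.neighborFinset w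
  have hball : ∀ v ∈ C, (ball v).card ≤ 1 + d + d * d := by
    intro v _
    refine (Finset.card_union_le _ _).trans (add_le_add ?_ ?_)
    · refine (Finset.card_insert_le _ _).trans ?_
      have := hd v
      rw [H.card_neighborFinset_eq_degree]
      omega
    · refine (Finset.card_biUnion_le_card_mul _ _ d fun w _ => ?_).trans ?_
      · simpa using hd w
      · exact Nat.mul_le_mul_right _ (by simpa using hd v)
  refine le_trans ?_ (Finset.card_biUnion_le_card_mul C ball _ hball)
  rw [← Finset.card_univ]
  refine Finset.card_le_card fun u _ => ?_
  by_contra hu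
  have hu' : ∀ v ∈ C, u ≠ v ∧ ¬ H.Adj v u ∧ ∀ w, H.Adj v w → ¬ H.Adj w u := by
    intro v hv
    refine ⟨?_, ?_, ?_⟩
    · rintro rfl
      exact hu (Finset.mem_biUnion.2 ⟨_, hv, by simp [ball]⟩)
    · exact fun h => hu (Finset.mem_biUnion.2 ⟨v, hv, by simp [ball, h]⟩)
    · exact fun w h h' => hu (Finset.mem_biUnion.2 ⟨v, hv, by
        simp only [ball, Finset.mem_union, Finset.mem_biUnion, SimpleGraph.mem_neighborFinset]
        exact Or.inr ⟨w, h, h'⟩⟩)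
  have hP : P (insert u C) := by
    refine ⟨fun x hx y hy h => ?_, fun w x hx y hy hwx hwy => ?_⟩
    · rcases Finset.mem_insert.1 hx with rfl | hx' <;>
        rcases Finset.mem_insert.1 hy with rfl | hy'
      · exact H.irrefl h
      · exact (hu' y hy').2.1 h.symm
      · exact (hu' x hx').2.1 h
      · exact hC.prop.1 x hx' y hy' h
    · rcases Finset.mem_insert.1 hx with rfl | hx' <;>
        rcases Finset.mem_insert.1 hy with rfl | hy'
      · rfl
      · exact absurd hwx ((hu' y hy').2.2 w hwy.symm)
      · exact absurd hwy ((hu' x hx').2.2 w hwx.symm)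
      · exact hC.prop.2 w x hx' y hy' hwx hwy
  have huC : u ∈ C := hC.le_of_ge hP (Finset.subset_insert u C) (Finset.mem_insert_self u C)
  exact (hu' u huC).1 rfl

section Copies

variable {V A W : Type*} [DecidableEq V]

/-- The vertex by which the copy with choice function `ε` represents `u`. A centre `u ∈ C` carries
the label `ε u`; any other vertex carries the first half of the label of the centre `c u`. -/
def copyMap (C : Finset V) (c : V → C) (a₀ : A) (e : V × A × A ≃ W) (ε : C → A × A) (u : V) : W :=
  e (u, if h : u ∈ C then ε ⟨u, h⟩ else ((ε (c u)).1, a₀))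

theorem copyMap_fst (C : Finset V) (c : V → C) (a₀ : A) (e : V × A × A ≃ W) (ε : C → A × A)
    (u : V) : (e.symm (copyMap C c a₀ e ε u)).1 = u := by
  simp [copyMap]

/-- The union of the copies of `H` over all choice functions. -/
def copyGraph (H : SimpleGraph V) (C : Finset V) (c : V → C) (a₀ : A) (e : V × A × A ≃ W) :
    SimpleGraph W where
  Adj x y := ∃ ε u v, H.Adj u v ∧ copyMap C c a₀ e ε u = x ∧ copyMap C c a₀ e ε v = y
  symm := ⟨fun _ _ ⟨ε, u, v, h, hu, hv⟩ => ⟨ε, v, u, h.symm, hv, hu⟩⟩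
  loopless := ⟨by
    rintro x ⟨ε, u, v, h, rfl, hv⟩
    have := congrArg (fun z => (e.symm z).1) hv
    simp only [copyMap_fst] at this
    exact h.ne this.symm⟩

/-- Every copy is induced. -/
def copyEmbedding (H : SimpleGraph V) (C : Finset V) (c : V → C) (a₀ : A) (e : V × A × A ≃ W)
    (ε : C → A × A) : H ↪g copyGraph H C c a₀ e where
  toFun := copyMap C c a₀ e ε
  inj' u v h := by simpa only [copyMap_fst] using congrArg (fun z => (e.symm z).1) h
  map_rel_iff' := by
    intro u v
    refine ⟨?_, fun h => ⟨ε, u, v, h, rfl, rfl⟩⟩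
    -- An edge coming from any other copy still projects to an edge of `H`.
    rintro ⟨ε', u', v', h, hu, hv⟩
    have hu : copyMap C c a₀ e ε' u' = copyMap C c a₀ e ε u := hu
    have hv : copyMap C c a₀ e ε' v' = copyMap C c a₀ e ε v := hv
    replace hu := congrArg (fun z => (e.symm z).1) hu
    replace hv := congrArg (fun z => (e.symm z).1) hv
    simp only [copyMap_fst] at hu hv
    rwa [← hu, ← hv]

/-- A neighbour over `v` is fixed by `v` and one element of `A`. If `v ∈ C`, the given vertex is not
a centre and already shows the first half of the label of `v`, so only the second half is free. If
`v ∉ C`, only a first half is shown. -/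
theorem copyGraph_degree_le [Fintype V] [Fintype A] [Fintype W] (H : SimpleGraph V)
    [DecidableRel H.Adj] (C : Finset V) (c : V → C) (a₀ : A) (e : V × A × A ≃ W)
    [DecidableRel (copyGraph H C c a₀ e).Adj] (d : ℕ) (hd : ∀ u, H.degree u ≤ d)
    (hC : ∀ u ∈ C, ∀ v ∈ C, ¬ H.Adj u v) (hc : ∀ w, ∀ u ∈ C, H.Adj w u → (c w : V) = u) (x : W) :
    (copyGraph H C c a₀ e).degree x ≤ d * Fintype.card A := by
  classical
  obtain ⟨⟨u, a, b⟩, rfl⟩ := e.surjective x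
  rw [← SimpleGraph.card_neighborFinset_eq_degree]
  let g : V × A → W := fun q => e (q.1, if q.1 ∈ C then (a, q.2) else (q.2, a₀))
  have hsub : (copyGraph H C c a₀ e).neighborFinset (e (u, a, b)) ⊆
      (H.neighborFinset u ×ˢ Finset.univ).image g := by
    intro y hy
    rw [SimpleGraph.mem_neighborFinset] at hy
    obtain ⟨ε, u', v, h, hu, rfl⟩ := hy
    rw [copyMap, e.apply_eq_iff_eq, Prod.mk.injEq] at hu
    obtain ⟨rfl, hu⟩ := hu
    rw [Finset.mem_image]
    by_cases hv : v ∈ C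
    · refine ⟨(v, (ε ⟨v, hv⟩).2), by simpa using h, ?_⟩
      have huC : u' ∉ C := fun hu' => hC u' hu' v hv h
      have hcu : c u' = ⟨v, hv⟩ := Subtype.ext (hc u' v hv h)
      rw [dif_neg huC, hcu, Prod.mk.injEq] at hu
      simp [g, copyMap, hv, ← hu.1]
    · exact ⟨(v, (ε (c v)).1), by simpa using h, by simp [g, copyMap, hv]⟩
  refine (Finset.card_le_card hsub).trans (Finset.card_image_le.trans ?_)
  rw [Finset.card_product, Finset.card_univ, SimpleGraph.card_neighborFinset_eq_degree]
  exact Nat.mul_le_mul_right _ (hd u)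

theorem two_pow_card_le_ncard_maximal_copies [Fintype V] [Fintype A] [Fintype W]
    (H : SimpleGraph V) (C : Finset V) (c : V → C) (a₀ : A) (e : V × A × A ≃ W)
    [DecidableRel (copyGraph H C c a₀ e).Adj] (hadj : ∀ u, ∃ v, H.Adj u v) (D K : ℕ) (hK : 0 < K)
    (hA : Fintype.card A * Fintype.card A = 2 * K)
    (hD : ∀ x, (copyGraph H C c a₀ e).degree x ≤ D) (hDK : D * Fintype.card V ≤ K * C.card)
    (P : Set W → Prop) (hP : ∀ B, P B → IsPrescribedBlowUp H ∅ ((copyGraph H C c a₀ e).induce B))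
    (hcopy : ∀ f : H ↪g copyGraph H C c a₀ e, P (Set.range f)) :
    2 ^ C.card ≤ {B | Maximal P B}.ncard := by
  rw [← Fintype.card_coe C] at hDK ⊢
  refine two_pow_card_le_ncard_maximal P
    (fun ε : C → A × A => Set.range (copyEmbedding H C c a₀ e ε)) (fun v l => e (v, l)) ?_
    (fun ε => hcopy _) (fun ε v => ⟨v, ?_⟩) K hK (by rw [Fintype.card_prod, hA])
    (fun B hB => ((hP B hB).ncard_le hadj D hD).trans hDK)
  · rintro ⟨v, l⟩ ⟨w, l'⟩ h
    have h := e.injective h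
    rw [Prod.mk.injEq] at h
    exact Prod.ext (Subtype.ext h.1) h.2
  · change copyMap C c a₀ e ε v = _
    simp [copyMap]

end Copies

/-- The left side is `q * k²` with `k = 2 * d * q`. Since `n = k² * N ≤ q * k² * |C|`, dividing `n`
by anything at least this large leaves an exponent of at most `|C|`. -/
theorem blowUp_constants_le {d : ℕ} (hd : 2 ≤ d) :
    (1 + d + d * d) * (2 * d * (1 + d + d * d)) ^ 2 ≤ 2 ^ d ^ (21 * d + 20) := by
  have hq : 1 + d + d * d ≤ d ^ 3 := by
    nlinarith [Nat.mul_le_mul hd hd, Nat.mul_le_mul_right (d * d) hd]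
  calc (1 + d + d * d) * (2 * d * (1 + d + d * d)) ^ 2 ≤ d ^ 3 * (d * d * d ^ 3) ^ 2 := by gcongr
    _ = d ^ 13 := by ring
    _ ≤ (2 ^ d) ^ 13 := by gcongr; exact Nat.lt_two_pow_self.le
    _ = 2 ^ (d * 13) := by rw [pow_mul]
    _ ≤ 2 ^ d ^ (21 * d + 20) := by
      refine Nat.pow_le_pow_right (by norm_num) ?_
      calc d * 13 ≤ d * d ^ 4 := by
            gcongr
            exact le_trans (by norm_num) (Nat.pow_le_pow_left hd 4)
        _ = d ^ 5 := by ring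
        _ ≤ _ := Nat.pow_le_pow_right (by omega) (by omega)

theorem mainTheorem5 {V : Type*} [Fintype V] (d : ℕ) (hd : 2 ≤ d)
    (H : SimpleGraph V) [DecidableRel H.Adj] (hconn : H.Connected) (hdeg : H.maxDegree = d)
    (hN : d ^ d ^ d ^ d < Fintype.card V) :
    ∃ (n : ℕ) (G : SimpleGraph (Fin n)) (_ : DecidableRel G.Adj),
      Fintype.card V ≤ n ∧
      n ≤ 2 ^ d ^ (21 * d + 20) * Fintype.card V ∧
      G.maxDegree ≤ d * 2 ^ d ^ (21 * d + 20) ∧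
      (∀ U : Set V,
        (2 : ℝ) ^ ((n : ℝ) / (2 : ℝ) ^ d ^ (21 * d + 20)) ≤
          ((maximalPrescribedBlowUps H U G).ncard : ℝ)) ∧
      (∀ Up Um : Set V, Disjoint Up Um →
        (2 : ℝ) ^ ((n : ℝ) / (2 : ℝ) ^ d ^ (21 * d + 20)) ≤
          ((maximalPrescribedInducedBlowUps H Up Um G).ncard : ℝ)) := by
  classical
  have hconst := blowUp_constants_le hd
  have hcast : (2 : ℝ) ^ d ^ (21 * d + 20) = ((2 ^ d ^ (21 * d + 20) : ℕ) : ℝ) := by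
    push_cast; rfl
  rw [hcast]
  clear hcast
  generalize 2 ^ d ^ (21 * d + 20) = D at hconst ⊢
  have hdeg' : ∀ u, H.degree u ≤ d := fun u => hdeg ▸ H.degree_le_maxDegree u
  have hcard : 1 < Fintype.card V := lt_of_le_of_lt (Nat.one_le_pow _ _ (by omega)) hN
  have : Nontrivial V := Fintype.one_lt_card_iff_nontrivial.1 hcard
  have hadj : ∀ u, ∃ v, H.Adj u v := fun u => hconn.preconnected.exists_adj_of_nontrivial u
  obtain ⟨C, hC, hC', hCcard⟩ := exists_scattered H d hdeg'
  set q := 1 + d + d * d with hq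
  -- Chosen so that `k * k = 2 * (d * q * k)`: half the labels per centre match the size bound for
  -- blow-ups.
  set k := 2 * d * q with hk
  have hq0 : 0 < q := by omega
  have hk0 : 0 < k := by positivity
  have hCne : C.Nonempty := by
    rw [← Finset.card_pos]
    by_contra h
    simp only [not_lt, Nat.le_zero] at h
    rw [h] at hCcard
    omega
  obtain ⟨v₀, hv₀⟩ := hCne
  -- A vertex has at most one neighbour in `C`; with none, the default `v₀` is harmless.
  let c : V → C := fun w =>
    if h : ∃ u ∈ C, H.Adj w u then ⟨h.choose, h.choose_spec.1⟩ else ⟨v₀, hv₀⟩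
  have hc : ∀ w, ∀ u ∈ C, H.Adj w u → (c w : V) = u := by
    intro w u hu hwu
    have h : ∃ u ∈ C, H.Adj w u := ⟨u, hu, hwu⟩
    simp only [c, dif_pos h]
    exact hC' w _ h.choose_spec.1 u hu h.choose_spec.2 hwu
  let n := Fintype.card V * (k * k)
  let e : V × Fin k × Fin k ≃ Fin n := Fintype.equivFinOfCardEq (by simp [n])
  let G := copyGraph H C c ⟨0, hk0⟩ e
  have hGdeg : ∀ x, G.degree x ≤ d * k := fun x => by
    simpa using copyGraph_degree_le H C c ⟨0, hk0⟩ e d hdeg' hC hc x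
  have hkD : q * k ^ 2 ≤ D := hconst
  have hkk : k * k ≤ D := le_trans (by nlinarith) hkD
  have hbound : ∀ M : ℕ, 2 ^ C.card ≤ M → (2 : ℝ) ^ ((n : ℝ) / (D : ℝ)) ≤ (M : ℝ) := by
    intro M hM
    have hD0 : 0 < D := lt_of_lt_of_le (by positivity) hkk
    have h1 : n ≤ C.card * D := by
      calc n ≤ C.card * q * (k * k) := Nat.mul_le_mul_right _ hCcard
        _ = C.card * (q * k ^ 2) := by ring
        _ ≤ C.card * D := Nat.mul_le_mul_left _ hkD
    calc (2 : ℝ) ^ ((n : ℝ) / (D : ℝ)) ≤ (2 : ℝ) ^ (C.card : ℝ) := by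
          refine Real.rpow_le_rpow_of_exponent_le (by norm_num) ?_
          rw [div_le_iff₀ (by exact_mod_cast hD0)]
          exact_mod_cast h1
      _ ≤ M := by
          rw [Real.rpow_natCast]
          exact_mod_cast hM
  have hmany : ∀ P : Set (Fin n) → Prop, (∀ B, P B → IsPrescribedBlowUp H ∅ (G.induce B)) →
      (∀ f : H ↪g G, P (Set.range f)) → 2 ^ C.card ≤ {B | Maximal P B}.ncard := by
    refine two_pow_card_le_ncard_maximal_copies H C c ⟨0, hk0⟩ e hadj (d * k) (d * q * k)
      (by positivity) (by rw [Fintype.card_fin, hk]; ring) hGdeg ?_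
    calc d * k * Fintype.card V ≤ d * k * (C.card * q) := Nat.mul_le_mul_left _ hCcard
      _ = d * q * k * C.card := by ring
  refine ⟨n, G, inferInstance, Nat.le_mul_of_pos_right _ (by positivity), ?_, ?_, ?_, ?_⟩
  · rw [mul_comm]
    exact Nat.mul_le_mul_left _ hkk
  · refine (G.maxDegree_le_of_forall_degree_le _ hGdeg).trans (Nat.mul_le_mul_left _ ?_)
    nlinarith
  · intro U
    refine hbound _ (hmany (fun B => IsPrescribedBlowUp H U (G.induce B))
      (fun B hB => ?_) fun f =>
      (isPrescribedInducedBlowUp_range U ∅ f).isPrescribedBlowUp)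
    obtain ⟨φ, h1, h2, -⟩ := hB
    exact ⟨φ, h1, h2, by simp⟩
  · intro Up Um _
    refine hbound _ (hmany (fun B => IsPrescribedInducedBlowUp H Up Um (G.induce B))
      (fun B hB => ?_) fun f => isPrescribedInducedBlowUp_range Up Um f)
    obtain ⟨φ, h1, h2, -⟩ := hB
    exact ⟨φ, h1, h2, by simp⟩
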